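/- A local ring is a commutative noetherian ring with a unique maximal ideal. For a local ring $A$ with residue field $k_A$ and a finitely generated $A$-module $M$, the Poincaré series of $M$ over $A$ is the formal power series $$P^A_M(t)=\sum_{i\ge 0}\operatorname{rank}_{k_A}\big(\operatorname{Tor}^A_i(M,k_A)\big)\,t^i\in\mathbb{Z}[[t]].$$ Let $R$ and $S$ be local rings, and let $\alpha\colon S\to R$ and $\beta\colon R\to S$ be homomorphisms of rings such that $\beta\alpha=\mathrm{id}_S$. Then for every finitely generated $S$-module $N$, where $N$ and $S$ are viewed as $R$-modules via $\beta$, the vector spaces $\operatorname{Tor}^R_i(N,k_R)$, $\operatorname{Tor}^R_i(S,k_R)$ and $\operatorname{Tor}^S_i(N,k_S)$ are finite-dimensional for all $i$, so that the Poincaré series below are defined, and there is an equality of formal power series $$P^R_N(t)=P^R_S(t)\cdot P^S_N(t).$$ -/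

import Mathlib

open CategoryTheory

universe u

instance extendScalarsResidueAdditive (R : Type u) [CommRing R] [IsLocalRing R] :
    (ModuleCat.extendScalars.{u, u, u} (IsLocalRing.residue R)).Additive :=
  (ModuleCat.extendRestrictScalarsAdj.{u} (IsLocalRing.residue R)).left_adjoint_additive

/-- For a local ring `R` with residue field `k` and an `R`-module `M`, this is the `k`-vector space
`Tor_i^R(k, M) = Tor_i^R(M, k)`: the `i`-th left derived functor of `k ⊗_R - : Mod R ⥤ Mod k`,
evaluated at `M`; that is, the `i`-th homology of `k ⊗_R P` for a projective resolution
`P` of `M` over `R`, with the `k`-action coming from the factor `k`. -/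
noncomputable def torResidue (R : Type u) [CommRing R] [IsLocalRing R] (i : ℕ)
    (M : ModuleCat.{u} R) : ModuleCat.{u} (IsLocalRing.ResidueField R) :=
  ((ModuleCat.extendScalars.{u, u, u} (IsLocalRing.residue R)).leftDerived i).obj M

/-- The Poincaré series `∑ i, rank_k Tor_i^R(M, k) t ^ i` of an `R`-module `M`, for a local ring
`R` with residue field `k`. -/
noncomputable def poincareSeries (R : Type u) [CommRing R] [IsLocalRing R]
    (M : ModuleCat.{u} R) : PowerSeries ℤ :=
  PowerSeries.mk fun i =>
    (Module.finrank (IsLocalRing.ResidueField R) (torResidue R i M) : ℤ)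

/-- The functor `k ⊗_R -` to `k`-modules, followed by restriction of scalars to `R`, is the functor
`k ⊗ -` of the monoidal category of `R`-modules. -/
noncomputable def extendScalarsResidueIso (R : Type u) [CommRing R] [IsLocalRing R] :
    ModuleCat.extendScalars.{u, u, u} (IsLocalRing.residue R) ⋙
        ModuleCat.restrictScalars (IsLocalRing.residue R) ≅
      MonoidalCategory.tensorLeft (ModuleCat.of R (IsLocalRing.ResidueField R)) :=
  NatIso.ofComponents (fun M => LinearEquiv.toModuleIso
    (LinearEquiv.refl R (TensorProduct R (IsLocalRing.ResidueField R) M))) (fun _ => rfl)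

/-- Comparison with Mathlib's `Tor`: the `R`-module underlying `torResidue R i M` is
`Tor_i^R(k, M)`. -/
noncomputable def torResidueIsoTor (R : Type u) [CommRing R] [IsLocalRing R] (i : ℕ)
    (M : ModuleCat.{u} R) :
    (ModuleCat.restrictScalars (IsLocalRing.residue R)).obj (torResidue R i M) ≅
      ((Tor (ModuleCat.{u} R) i).obj (ModuleCat.of R (IsLocalRing.ResidueField R))).obj M :=
  let P := projectiveResolution M
  let E := ModuleCat.extendScalars.{u, u, u} (IsLocalRing.residue R)
  let G := ModuleCat.restrictScalars.{u} (IsLocalRing.residue R)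
  G.mapIso (P.isoLeftDerivedObj E i) ≪≫
    ((((E.mapHomologicalComplex _).obj P.complex).sc i).mapHomologyIso G).symm ≪≫
    HomologicalComplex.homologyMapIso
      ((NatIso.mapHomologicalComplex (extendScalarsResidueIso R)
        (ComplexShape.down ℕ)).app P.complex) i ≪≫
    (P.isoLeftDerivedObj
      (MonoidalCategory.tensorLeft (ModuleCat.of R (IsLocalRing.ResidueField R))) i).symm

/-! In a minimal free resolution the differentials vanish modulo the maximal ideal, so the ranks of
the free modules are the coefficients of the Poincaré series. Take minimal resolutions `G` of `N`
over `S` and `F` of `S` over `R`, and form the double complex `G ⊗_S F`, with `S` acting on `F`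
through `α`. Each column is a finite sum of copies of `F`, hence resolves `G_p`. Since `βα = id`,
the augmentations induce the differential of `G` itself, and `exists_total_boundary` shows that the
total complex resolves `N`. It is minimal because `α` is local. Its ranks are the convolution of
those of `F` and `G`, which is the product of the series. -/

open TensorProduct in
/-- A finitely generated module over a local ring has a minimal free cover. -/
theorem exists_minimal_cover (A : Type*) [CommRing A] [IsLocalRing A] (M : Type*)
    [AddCommGroup M] [Module A M] [Module.Finite A M] :
    ∃ (n : ℕ) (f : (Fin n → A) →ₗ[A] M), Function.Surjective f ∧
      ∀ x, f x = 0 → ∀ i, x i ∈ IsLocalRing.maximalIdeal A := by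
  let k := IsLocalRing.ResidueField A
  let b := Module.finBasis k (k ⊗[A] M)
  -- As `A → k` is surjective, every element of `k ⊗ M` has the form `1 ⊗ m`; thus the basis lifts
  -- to `M`, and by Nakayama the lifts generate.
  obtain ⟨v, hv⟩ := (TensorProduct.mk_surjective A M k
    Ideal.Quotient.mk_surjective).comp_left b
  have hv' (i) : (1 : k) ⊗ₜ[A] v i = b i := congr_fun hv i
  refine ⟨_, Fintype.linearCombination A v, ?_, fun x hx i => ?_⟩
  · rw [← LinearMap.range_eq_top, Fintype.range_linearCombination]
    exact IsLocalRing.span_eq_top_of_tmul_eq_basis v b hv'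
  · have h : ∑ i, algebraMap A k (x i) • b i = 0 := by
      have := congr_arg (fun m => (1 : k) ⊗ₜ[A] m) hx
      simp only [Fintype.linearCombination_apply, TensorProduct.tmul_sum,
        TensorProduct.tmul_smul, hv', TensorProduct.tmul_zero] at this
      simpa only [algebraMap_smul] using this
    have := Fintype.linearIndependent_iff.1 b.linearIndependent _ h i
    exact (IsLocalRing.residue_eq_zero_iff _).1 this

/-- A minimal resolution of a module over a local ring by free modules of finite rank. -/
structure MinimalFreeResolution (A : Type u) [CommRing A] [IsLocalRing A] (M : Type u)
    [AddCommGroup M] [Module A M] where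
  /-- the indices of the standard basis of the `n`-th free module -/
  ι : ℕ → Type
  [fintype : ∀ n, Fintype (ι n)]
  /-- the differential -/
  d : ∀ n, (ι (n + 1) → A) →ₗ[A] (ι n → A)
  /-- the augmentation -/
  aug : (ι 0 → A) →ₗ[A] M
  aug_surjective : Function.Surjective aug
  aug_d : ∀ x, aug (d 0 x) = 0
  d_d : ∀ n x, d n (d (n + 1) x) = 0
  exact_zero : ∀ x, aug x = 0 → ∃ y, d 0 y = x
  exact_succ : ∀ n x, d n x = 0 → ∃ y, d (n + 1) y = x
  minimal : ∀ n x i, d n x i ∈ IsLocalRing.maximalIdeal A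

attribute [instance] MinimalFreeResolution.fintype

namespace MinimalFreeResolution

/-! ### Existence of minimal free resolutions -/

section Existence

variable (A : Type u) [CommRing A] [IsLocalRing A]

/-- The rank of a minimal free cover of a submodule of a free module. -/
noncomputable def coverRank [IsNoetherianRing A] (K : Σ n : ℕ, Submodule A (Fin n → A)) : ℕ :=
  (exists_minimal_cover A K.2).choose

/-- A minimal free cover of a submodule of a free module. -/
noncomputable def cover [IsNoetherianRing A] (K : Σ n : ℕ, Submodule A (Fin n → A)) :
    (Fin (coverRank A K) → A) →ₗ[A] K.2 :=
  (exists_minimal_cover A K.2).choose_spec.choose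

variable {A} in
theorem cover_surjective [IsNoetherianRing A] (K : Σ n : ℕ, Submodule A (Fin n → A)) :
    Function.Surjective (cover A K) :=
  (exists_minimal_cover A K.2).choose_spec.choose_spec.1

variable {A} in
theorem cover_minimal [IsNoetherianRing A] (K : Σ n : ℕ, Submodule A (Fin n → A))
    (x) (hx : cover A K x = 0) (i) : x i ∈ IsLocalRing.maximalIdeal A :=
  (exists_minimal_cover A K.2).choose_spec.choose_spec.2 x hx i

/-- The iterated syzygies of a submodule of a free module. -/
noncomputable def syzygy [IsNoetherianRing A] (K : Σ n : ℕ, Submodule A (Fin n → A)) :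
    ℕ → Σ n : ℕ, Submodule A (Fin n → A)
  | 0 => K
  | n + 1 => ⟨_, LinearMap.ker (cover A (syzygy K n))⟩

theorem nonempty [IsNoetherianRing A] (M : Type u) [AddCommGroup M] [Module A M]
    [Module.Finite A M] : Nonempty (MinimalFreeResolution A M) := by
  obtain ⟨n, f, hf, hm⟩ := exists_minimal_cover A M
  -- `K n` is the kernel inside the `n`-th free module: its ambient rank is the `n`-th rank, and its
  -- cover gives `d n`.
  let K := syzygy A ⟨n, LinearMap.ker f⟩
  have hK (n : ℕ) : ∀ x ∈ (K n).2, ∀ i, x i ∈ IsLocalRing.maximalIdeal A := by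
    cases n with
    | zero => exact fun x hx => hm x hx
    | succ n => exact fun x hx => cover_minimal (K n) x hx
  exact ⟨{
    ι := fun n => Fin (K n).1
    d := fun n => (K n).2.subtype ∘ₗ cover A (K n)
    aug := f
    aug_surjective := hf
    aug_d := fun x => (cover A (K 0) x).2
    d_d := fun n x => congr_arg Subtype.val (cover A (K (n + 1)) x).2
    exact_zero := fun x hx => by
      obtain ⟨y, hy⟩ := cover_surjective (K 0) ⟨x, hx⟩
      exact ⟨y, congr_arg Subtype.val hy⟩
    exact_succ := fun n x hx => by
      obtain ⟨y, hy⟩ := cover_surjective (K (n + 1)) ⟨x, Subtype.ext hx⟩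
      exact ⟨y, congr_arg Subtype.val hy⟩
    minimal := fun n x => hK n _ (cover A (K n) x).2 }⟩

end Existence

/-! ### Ranks of a minimal resolution as Betti numbers -/

section Tor

variable {A : Type u} [CommRing A] [IsLocalRing A] {M : ModuleCat.{u} A}
  (F : MinimalFreeResolution A M)

/-- The chain complex underlying a minimal free resolution. -/
noncomputable def complex : ChainComplex (ModuleCat.{u} A) ℕ :=
  ChainComplex.of (fun n => ModuleCat.of A (F.ι n → A)) (fun n => ModuleCat.ofHom (F.d n))
    (fun n => by ext1; exact LinearMap.ext (F.d_d n))

theorem complex_d (n : ℕ) : F.complex.d (n + 1) n = ModuleCat.ofHom (F.d n) :=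
  ChainComplex.of_d (V := ModuleCat.{u} A) (fun n => ModuleCat.of A (F.ι n → A))
    (fun n => ModuleCat.ofHom (F.d n)) n

/-- The augmentation of a minimal free resolution as a morphism of complexes. -/
noncomputable def complexπ : F.complex ⟶ (ChainComplex.single₀ (ModuleCat.{u} A)).obj M :=
  (F.complex.toSingle₀Equiv M).symm ⟨ModuleCat.ofHom F.aug, by
    rw [complex_d]; ext1; exact LinearMap.ext F.aug_d⟩

theorem complexπ_f_zero : F.complexπ.f 0 = ModuleCat.ofHom F.aug :=
  ChainComplex.toSingle₀Equiv_symm_apply_f_zero _ _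

theorem quasiIso_complexπ : QuasiIso F.complexπ where
  quasiIsoAt n := by
    cases n with
    | zero =>
      rw [ChainComplex.quasiIsoAt₀_iff, ShortComplex.quasiIso_iff_of_zeros' _ rfl rfl rfl]
      constructor
      · rw [ShortComplex.moduleCat_exact_iff]
        intro x hx
        have hx' : F.aug x = 0 := by
          have : (F.complexπ.f 0) x = 0 := hx
          rwa [complexπ_f_zero] at this
        obtain ⟨y, hy⟩ := F.exact_zero x hx'
        refine ⟨y, ?_⟩
        change (F.complex.d 1 0) y = x
        rw [complex_d]
        exact hy
      · change Epi (F.complexπ.f 0)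
        rw [complexπ_f_zero]
        exact (ModuleCat.epi_iff_surjective (ModuleCat.ofHom F.aug)).2 F.aug_surjective
    | succ n =>
      rw [quasiIsoAt_iff_exactAt' (hL := ChainComplex.exactAt_succ_single_obj ..),
        HomologicalComplex.exactAt_iff' _ (n + 2) (n + 1) n (by simp) (by simp),
        ShortComplex.moduleCat_exact_iff]
      intro x hx
      have hx' : F.d n x = 0 := by
        have : (F.complex.d (n + 1) n) x = 0 := hx
        rwa [complex_d] at this
      obtain ⟨y, hy⟩ := F.exact_succ n x hx'
      refine ⟨y, ?_⟩
      change (F.complex.d (n + 1 + 1) (n + 1)) y = x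
      rw [complex_d]
      exact hy

/-- A minimal free resolution as a projective resolution. -/
noncomputable def toProjectiveResolution : ProjectiveResolution M where
  complex := F.complex
  projective n := (IsProjective.iff_projective (R := A) (P := (F.ι n → A))).1 inferInstance
  π := F.complexπ
  quasiIso := F.quasiIso_complexπ

/-- The matrix entries lie in the maximal ideal, so they die in the residue field. -/
theorem extendScalars_map_d (n : ℕ) :
    (ModuleCat.extendScalars.{u, u, u} (IsLocalRing.residue A)).map
      (ModuleCat.ofHom (F.d n)) = 0 := by
  classical
  apply ModuleCat.ExtendScalars.hom_ext
  intro x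
  let : Module A (IsLocalRing.ResidueField A) := Module.compHom _ (IsLocalRing.residue A)
  change (1 : IsLocalRing.ResidueField A) ⊗ₜ[A] F.d n x = 0
  rw [pi_eq_sum_univ' (F.d n x), TensorProduct.tmul_sum]
  refine Finset.sum_eq_zero fun i _ => ?_
  rw [← TensorProduct.smul_tmul]
  have : F.d n x i • (1 : IsLocalRing.ResidueField A) = 0 := by
    change IsLocalRing.residue A (F.d n x i) * 1 = 0
    rw [(IsLocalRing.residue_eq_zero_iff _).2 (F.minimal n x i), zero_mul]
  exact (congr_arg (· ⊗ₜ[A] (Pi.single i 1 : F.ι n → A)) this).trans (TensorProduct.zero_tmul _ _)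

theorem extendScalars_map_complex_d (i j : ℕ) :
    (ModuleCat.extendScalars.{u, u, u} (IsLocalRing.residue A)).map (F.complex.d i j) = 0 := by
  by_cases h : j + 1 = i
  · subst h
    rw [complex_d]
    exact F.extendScalars_map_d j
  · rw [F.complex.shape i j h, Functor.map_zero]

/-- The residue field tensored with a free module, in terms of the standard basis. -/
noncomputable def torResidueIso (i : ℕ) : torResidue A i M ≅
    (ModuleCat.extendScalars.{u, u, u} (IsLocalRing.residue A)).obj
      (ModuleCat.of A (F.ι i → A)) :=
  F.toProjectiveResolution.isoLeftDerivedObj _ i ≪≫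
    (ShortComplex.HomologyData.ofZeros
      ((((ModuleCat.extendScalars.{u, u, u} (IsLocalRing.residue A)).mapHomologicalComplex
        _).obj F.complex).sc i)
      (F.extendScalars_map_complex_d _ _) (F.extendScalars_map_complex_d _ _)).left.homologyIso

/-- Base change of a finite free module along the residue map. -/
noncomputable def extendScalarsEquiv (ι : Type) [Fintype ι] :
    (ModuleCat.extendScalars.{u, u, u} (IsLocalRing.residue A)).obj
      (ModuleCat.of A (ι → A)) ≃ₗ[IsLocalRing.ResidueField A] (ι → IsLocalRing.ResidueField A) := by
  classical
  exact TensorProduct.piScalarRight A (IsLocalRing.ResidueField A) (IsLocalRing.ResidueField A) ι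

/-- The homology of the base change of a minimal resolution is the base change itself. -/
noncomputable def torResidueEquiv (i : ℕ) :
    torResidue A i M ≃ₗ[IsLocalRing.ResidueField A] (F.ι i → IsLocalRing.ResidueField A) :=
  (F.torResidueIso i).toLinearEquiv.trans (extendScalarsEquiv (F.ι i))

theorem finite_torResidue (F : MinimalFreeResolution A M) (i : ℕ) :
    Module.Finite (IsLocalRing.ResidueField A) (torResidue A i M) :=
  Module.Finite.equiv (F.torResidueEquiv i).symm

theorem finrank_torResidue (i : ℕ) :
    Module.finrank (IsLocalRing.ResidueField A) (torResidue A i M) = Fintype.card (F.ι i) := by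
  rw [(F.torResidueEquiv i).finrank_eq, Module.finrank_pi]

end Tor

end MinimalFreeResolution

/-! ### Acyclicity of a double complex with exact columns -/

/-- In a first quadrant double complex with anticommuting differentials whose columns resolve an
exact complex, every cycle of the total complex is a boundary. -/
theorem exists_total_boundary {X : ℕ → ℕ → Type*} [∀ p q, AddCommGroup (X p q)] {Y : ℕ → Type*}
    [∀ p, AddCommGroup (Y p)]
    (dh : ∀ p q, X (p + 1) q →+ X p q) (dv : ∀ p q, X p (q + 1) →+ X p q)
    (ε : ∀ p, X p 0 →+ Y p) (δ : ∀ p, Y (p + 1) →+ Y p)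
    (dh_dh : ∀ p q x, dh p q (dh (p + 1) q x) = 0)
    (dh_dv : ∀ p q x, dh p q (dv (p + 1) q x) = -dv p q (dh p (q + 1) x))
    (ε_dh : ∀ p x, ε p (dh p 0 x) = δ p (ε (p + 1) x))
    (ε_dv : ∀ p x, ε p (dv p 0 x) = 0)
    (ε_surjective : ∀ p, Function.Surjective (ε p))
    (ε_exact : ∀ p x, ε p x = 0 → ∃ y, dv p 0 y = x)
    (dv_exact : ∀ p q x, dv p q x = 0 → ∃ y, dv p (q + 1) y = x)
    (δ_exact : ∀ p x, δ p x = 0 → ∃ y, δ (p + 1) y = x)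
    (x : ∀ p q, X p q) (hx : ∀ p q, dh p q (x (p + 1) q) + dv p q (x p (q + 1)) = 0)
    (hx₀ : ∃ y, δ 0 y = ε 0 (x 0 0)) :
    ∃ y : ∀ p q, X p q, ∀ p q, dh p q (y (p + 1) q) + dv p q (y p (q + 1)) = x p q := by
  have h₀ (p : ℕ) : ∃ z, δ p z = ε p (x p 0) := by
    cases p with
    | zero => exact hx₀
    | succ p =>
      apply δ_exact
      rw [← ε_dh, eq_neg_of_add_eq_zero_left (hx p 0), map_neg, ε_dv, neg_zero]
  have h₁ (p : ℕ) : ∃ z : X (p + 1) 0, ∃ w, dv p 0 w = x p 0 - dh p 0 z := by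
    obtain ⟨z, hz⟩ := h₀ p
    obtain ⟨z, rfl⟩ := ε_surjective _ z
    exact ⟨z, ε_exact _ _ (by rw [map_sub, ε_dh, hz, sub_self])⟩
  choose z hz using h₁
  -- The rows of `y` are built by induction on `q`; `H q y` says that row `q` admits a next row.
  let H (q : ℕ) (y : ∀ p, X p q) : Prop := ∀ p, ∃ w, dv p q w = x p q - dh p q (y (p + 1))
  have step (q : ℕ) (y : {y : ∀ p, X p q // H q y}) :
      ∃ y' : {y : ∀ p, X p (q + 1) // H (q + 1) y},
        ∀ p, dv p q (y'.1 p) = x p q - dh p q (y.1 (p + 1)) := by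
    choose w hw using y.2
    refine ⟨⟨w, fun p => dv_exact _ _ _ ?_⟩, hw⟩
    rw [map_sub, ← neg_eq_iff_eq_neg.2 (dh_dv p q (w (p + 1))), hw, map_sub, dh_dh, sub_zero,
      sub_neg_eq_add, add_comm, hx]
  choose next hnext using step
  -- The corner entry is arbitrary, here `0`: no equation involves it.
  let y (q : ℕ) : {y : ∀ p, X p q // H q y} :=
    Nat.rec ⟨fun p => Nat.casesOn p 0 z, hz⟩ next q
  refine ⟨fun p q => (y q).1 p, fun p q => ?_⟩
  rw [show dv p q ((y (q + 1)).1 p) = _ from hnext q (y q) p, add_sub_cancel]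

/-! ### The double complex `G ⊗ F` -/

namespace MinimalFreeResolution

/-- The matrix form is needed because `dh` applies `α` to the entries of `G.d`. -/
theorem d_apply {A M : Type u} [CommRing A] [IsLocalRing A] [AddCommGroup M] [Module A M]
    (F : MinimalFreeResolution A M) [∀ n, DecidableEq (F.ι n)] (n : ℕ) (x : F.ι (n + 1) → A)
    (i : F.ι n) : F.d n x i = ∑ j, x j * F.d n (Pi.single j 1) i := by
  conv_lhs => rw [LinearMap.pi_apply_eq_sum_univ (F.d n) x]
  simp only [Finset.sum_apply, Pi.smul_apply, smul_eq_mul]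
  refine Finset.sum_congr rfl fun j _ => congr_arg (fun v => x j * F.d n v i) ?_
  ext k
  simp [Pi.single_apply, eq_comm]

variable {R S N : Type u} [CommRing R] [IsLocalRing R] [CommRing S] [IsLocalRing S] [Algebra R S]
  [AddCommGroup N] [Module S N]
  (α : S →+* R) (G : MinimalFreeResolution S N) (F : MinimalFreeResolution R S)

open Classical in
/-- The differential of the first factor of `G ⊗ F`, where `F` is seen as a complex of `S`-modules
via `α`. -/
noncomputable def dh (p q : ℕ) :
    (G.ι (p + 1) → F.ι q → R) →ₗ[R] (G.ι p → F.ι q → R) :=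
  LinearMap.pi fun i => ∑ j, α (G.d p (Pi.single j 1) i) • LinearMap.proj j

/-- The differential of the second factor of `G ⊗ F`, up to sign. -/
noncomputable def dv (p q : ℕ) :
    (G.ι p → F.ι (q + 1) → R) →ₗ[R] (G.ι p → F.ι q → R) :=
  (-1 : R) ^ p • (F.d q).compLeft (G.ι p)

/-- The augmentation of the second factor of `G ⊗ F`. -/
noncomputable def augCol (p : ℕ) : (G.ι p → F.ι 0 → R) →ₗ[R] (G.ι p → S) :=
  F.aug.compLeft (G.ι p)

open Classical in
theorem dh_apply (p q : ℕ) (x : G.ι (p + 1) → F.ι q → R) (i : G.ι p) :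
    dh α G F p q x i = ∑ j, α (G.d p (Pi.single j 1) i) • x j := by
  simp [dh]

theorem dv_apply (p q : ℕ) (x : G.ι p → F.ι (q + 1) → R) (i : G.ι p) :
    dv G F p q x i = (-1 : R) ^ p • F.d q (x i) := rfl

theorem augCol_apply (p : ℕ) (x : G.ι p → F.ι 0 → R) (i : G.ι p) :
    augCol G F p x i = F.aug (x i) := rfl

theorem dh_dh (p q : ℕ) (x) : dh α G F p q (dh α G F (p + 1) q x) = 0 := by
  classical
  ext1 i
  simp only [dh_apply, Finset.smul_sum, smul_smul]
  rw [Finset.sum_comm]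
  refine Finset.sum_eq_zero fun k _ => ?_
  rw [← Finset.sum_smul]
  have := congr_fun (G.d_d p (Pi.single k 1)) i
  rw [d_apply] at this
  have := congr_arg α this
  simp only [map_sum, map_mul, Pi.zero_apply, map_zero] at this
  simp_rw [mul_comm (α (G.d p _ i))]
  rw [this, zero_smul]

theorem dv_dv (p q : ℕ) (x) : dv G F p q (dv G F p (q + 1) x) = 0 := by
  ext1 i
  simp only [dv_apply, map_smul, F.d_d, smul_zero, Pi.zero_apply]

/-- `F.d` is linear over `R`, so it commutes with the matrices of `dh`; the sign is the change from
`(-1) ^ p` to `(-1) ^ (p + 1)`. -/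
theorem dh_dv (p q : ℕ) (x) :
    dh α G F p q (dv G F (p + 1) q x) = -dv G F p q (dh α G F p (q + 1) x) := by
  ext1 i
  simp only [Pi.neg_apply, dh_apply, dv_apply, map_sum, map_smul, pow_succ, Finset.smul_sum,
    ← Finset.sum_neg_distrib, mul_neg, mul_one, neg_smul, smul_neg]
  exact Finset.sum_congr rfl fun j _ => congr_arg _ (smul_comm _ _ _)

theorem augCol_dv (p : ℕ) (x) : augCol G F p (dv G F p 0 x) = 0 := by
  ext1 i
  simp only [augCol_apply, dv_apply, map_smul, F.aug_d, smul_zero, Pi.zero_apply]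

theorem augCol_surjective (p : ℕ) : Function.Surjective (augCol G F p) :=
  F.aug_surjective.comp_left

theorem augCol_exact (p : ℕ) (x) (hx : augCol G F p x = 0) : ∃ y, dv G F p 0 y = x := by
  choose y hy using fun i => F.exact_zero (x i) (congr_fun hx i)
  refine ⟨(-1 : R) ^ p • y, ?_⟩
  ext1 i
  rw [dv_apply, Pi.smul_apply, map_smul, hy, smul_smul, ← mul_pow]
  simp

theorem dv_exact (p q : ℕ) (x) (hx : dv G F p q x = 0) : ∃ y, dv G F p (q + 1) y = x := by
  have hx' (i) : F.d q (x i) = 0 := by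
    have := congr_arg (fun z => (-1 : R) ^ p • z) (congr_fun hx i)
    simpa [dv_apply, smul_smul, ← mul_pow] using this
  choose y hy using fun i => F.exact_succ q (x i) (hx' i)
  refine ⟨(-1 : R) ^ p • y, ?_⟩
  ext1 i
  rw [dv_apply, Pi.smul_apply, map_smul, hy, smul_smul, ← mul_pow]
  simp

/-- The retraction enters here: the augmentation turns the entry `α s` back into `s`. -/
theorem augCol_dh (hα : ∀ s, algebraMap R S (α s) = s) (p : ℕ) (x) :
    augCol G F p (dh α G F p 0 x) = G.d p (augCol G F (p + 1) x) := by
  classical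
  ext1 i
  rw [augCol_apply, dh_apply, d_apply, map_sum]
  refine Finset.sum_congr rfl fun j _ => ?_
  rw [map_smul, Algebra.smul_def, hα, mul_comm, augCol_apply]

/-- The families of elements of the double complex `G ⊗ F`. -/
abbrev Plane : Type u := ∀ p q, G.ι p → F.ι q → R

/-- The total differential of `G ⊗ F`. -/
noncomputable def totalD : Plane G F →ₗ[R] Plane G F :=
  LinearMap.pi fun p => LinearMap.pi fun q =>
    dh α G F p q ∘ₗ LinearMap.proj q ∘ₗ LinearMap.proj (p + 1) +
      dv G F p q ∘ₗ LinearMap.proj (q + 1) ∘ₗ LinearMap.proj p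

theorem totalD_apply (x : Plane G F) (p q : ℕ) :
    totalD α G F x p q = dh α G F p q (x (p + 1) q) + dv G F p q (x p (q + 1)) := rfl

theorem totalD_totalD (x : Plane G F) : totalD α G F (totalD α G F x) = 0 := by
  ext1 p; ext1 q
  simp only [totalD_apply, map_add, dh_dh, dh_dv, dv_dv, Pi.zero_apply]
  abel

theorem exists_totalD_eq (hα : ∀ s, algebraMap R S (α s) = s)
    (x : Plane G F) (hx : totalD α G F x = 0)
    (hx₀ : ∃ y, G.d 0 y = augCol G F 0 (x 0 0)) : ∃ y, totalD α G F y = x := by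
  obtain ⟨y, hy⟩ := exists_total_boundary
    (fun p q => (dh α G F p q).toAddMonoidHom) (fun p q => (dv G F p q).toAddMonoidHom)
    (fun p => (augCol G F p).toAddMonoidHom) (fun p => (G.d p).toAddMonoidHom)
    (dh_dh α G F) (dh_dv α G F) (augCol_dh α G F hα) (augCol_dv G F) (augCol_surjective G F)
    (augCol_exact G F) (dv_exact G F) G.exact_succ x (fun p q => congr_fun (congr_fun hx p) q) hx₀
  exact ⟨y, funext fun p => funext fun q => hy p q⟩

/-! ### The total complex, degree by degree -/

/-- The indices of the standard basis of the total complex of `G ⊗ F` in degree `n`. -/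
abbrev TotalIndex (n : ℕ) : Type :=
  Σ pq : Finset.HasAntidiagonal.antidiagonal n, G.ι pq.1.1 × F.ι pq.1.2

/-- The component of degree `n` of a family. -/
def ofPlane (n : ℕ) : Plane G F →ₗ[R] (TotalIndex G F n → R) where
  toFun x k := x k.1.1.1 k.1.1.2 k.2.1 k.2.2
  map_add' _ _ := rfl
  map_smul' _ _ := rfl

/-- The family supported in degree `n` with a given component there. -/
def toPlane (n : ℕ) : (TotalIndex G F n → R) →ₗ[R] Plane G F where
  toFun x p q i j :=
    if h : p + q = n then x ⟨⟨(p, q), Finset.HasAntidiagonal.mem_antidiagonal.2 h⟩, (i, j)⟩ else 0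
  map_add' x y := by
    ext p q i j
    by_cases h : p + q = n <;> simp [h]
  map_smul' c x := by
    ext p q i j
    by_cases h : p + q = n <;> simp [h]

theorem ofPlane_apply (n : ℕ) (x : Plane G F) (k) :
    ofPlane G F n x k = x k.1.1.1 k.1.1.2 k.2.1 k.2.2 := rfl

theorem toPlane_ne {n p q : ℕ} (h : p + q ≠ n) (x) : toPlane G F n x p q = 0 := by
  ext i j
  exact dif_neg h

theorem toPlane_ofPlane {n p q : ℕ} (h : p + q = n) (x) :
    toPlane G F n (ofPlane G F n x) p q = x p q := by
  ext i j
  exact dif_pos h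

theorem ofPlane_toPlane (n : ℕ) (x) : ofPlane G F n (toPlane G F n x) = x := by
  ext ⟨⟨⟨p, q⟩, h⟩, i, j⟩
  exact dif_pos (Finset.HasAntidiagonal.mem_antidiagonal.1 h)

/-- The differential of the total complex of `G ⊗ F`. -/
noncomputable def tensorD (n : ℕ) : (TotalIndex G F (n + 1) → R) →ₗ[R] (TotalIndex G F n → R) :=
  ofPlane G F n ∘ₗ totalD α G F ∘ₗ toPlane G F (n + 1)

theorem tensorD_ofPlane (n : ℕ) (x : Plane G F) :
    tensorD α G F n (ofPlane G F (n + 1) x) = ofPlane G F n (totalD α G F x) := by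
  ext ⟨⟨⟨p, q⟩, h⟩, i, j⟩
  have h : p + q = n := Finset.HasAntidiagonal.mem_antidiagonal.1 h
  change totalD α G F (toPlane G F (n + 1) (ofPlane G F (n + 1) x)) p q i j =
    totalD α G F x p q i j
  rw [totalD_apply, toPlane_ofPlane G F (by omega), toPlane_ofPlane G F (by omega), totalD_apply]

/-- Outside degree `n` the total differential only meets zero components. -/
theorem totalD_toPlane_succ (n : ℕ) (x) (hx : tensorD α G F n x = 0) :
    totalD α G F (toPlane G F (n + 1) x) = 0 := by
  ext1 p; ext1 q
  by_cases h : p + q = n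
  · rw [← toPlane_ofPlane G F h (totalD α G F (toPlane G F (n + 1) x))]
    change toPlane G F n (tensorD α G F n x) p q = 0
    rw [hx, map_zero]; rfl
  · rw [totalD_apply, toPlane_ne G F (by omega), toPlane_ne G F (by omega), map_zero, map_zero,
      add_zero]; rfl

theorem totalD_toPlane_zero (x) : totalD α G F (toPlane G F 0 x) = 0 := by
  ext1 p; ext1 q
  rw [totalD_apply, toPlane_ne G F (by omega), toPlane_ne G F (by omega), map_zero, map_zero,
    add_zero]; rfl

variable [Module R N] [IsScalarTower R S N]

/-- The augmentation of the total complex of `G ⊗ F`. -/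
noncomputable def tensorAug : (TotalIndex G F 0 → R) →ₗ[R] N :=
  G.aug.restrictScalars R ∘ₗ augCol G F 0 ∘ₗ LinearMap.proj 0 ∘ₗ LinearMap.proj 0 ∘ₗ toPlane G F 0

theorem tensorAug_apply (x) :
    tensorAug G F x = G.aug (augCol G F 0 (toPlane G F 0 x 0 0)) := rfl

theorem tensorAug_ofPlane (x : Plane G F) :
    tensorAug G F (ofPlane G F 0 x) = G.aug (augCol G F 0 (x 0 0)) := by
  rw [tensorAug_apply, toPlane_ofPlane G F (by rfl)]

/-- If `α s` were a unit, so would be its image `s` in `S`. -/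
theorem map_mem_maximalIdeal (hα : ∀ s, algebraMap R S (α s) = s) {s : S} (hs : s ∈ IsLocalRing.maximalIdeal S) :
    α s ∈ IsLocalRing.maximalIdeal R := by
  rw [IsLocalRing.mem_maximalIdeal, mem_nonunits_iff] at hs ⊢
  intro h
  exact hs (hα s ▸ h.map (algebraMap R S))

/-- If `S` is a retract of `R`, the tensor product over `S` of a minimal `S`-free resolution of `N`
and a minimal `R`-free resolution of `S` is a minimal `R`-free resolution of `N`. -/
noncomputable def tensor (hα : ∀ s, algebraMap R S (α s) = s) :
    MinimalFreeResolution R N where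
  ι := TotalIndex G F
  d := tensorD α G F
  aug := tensorAug G F
  aug_surjective y := by
    obtain ⟨y, rfl⟩ := G.aug_surjective y
    obtain ⟨y, rfl⟩ := augCol_surjective G F 0 y
    refine ⟨ofPlane G F 0 (Pi.single 0 (Pi.single 0 y)), ?_⟩
    rw [tensorAug_ofPlane, Pi.single_eq_same, Pi.single_eq_same]
  aug_d x := by
    rw [← ofPlane_toPlane G F 1 x, tensorD_ofPlane, tensorAug_ofPlane, totalD_apply, map_add,
      augCol_dv, augCol_dh α G F hα, add_zero, G.aug_d]
  d_d n x := by
    rw [← ofPlane_toPlane G F _ x, tensorD_ofPlane, tensorD_ofPlane, totalD_totalD, map_zero]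
  exact_zero x hx := by
    obtain ⟨y, hy⟩ := exists_totalD_eq α G F hα _ (totalD_toPlane_zero α G F x)
      (G.exact_zero _ hx)
    exact ⟨ofPlane G F 1 y, by rw [tensorD_ofPlane, hy, ofPlane_toPlane]⟩
  exact_succ n x hx := by
    -- In positive degree the `(0, 0)` component is zero, so the corner condition is trivial.
    obtain ⟨y, hy⟩ := exists_totalD_eq α G F hα _ (totalD_toPlane_succ α G F n x hx)
      ⟨0, by rw [toPlane_ne G F (by omega), map_zero, map_zero]⟩
    exact ⟨ofPlane G F (n + 2) y, by rw [tensorD_ofPlane, hy, ofPlane_toPlane]⟩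
  minimal n x k := by
    classical
    rw [← ofPlane_toPlane G F _ x, tensorD_ofPlane, ofPlane_apply, totalD_apply, Pi.add_apply,
      Pi.add_apply, dh_apply, dv_apply, Finset.sum_apply]
    exact Ideal.add_mem _
      (Ideal.sum_mem _ fun j _ =>
        Ideal.mul_mem_right _ _ (map_mem_maximalIdeal α hα (G.minimal _ _ _)))
      (Ideal.mul_mem_left _ _ (F.minimal _ _ _))

theorem card_tensor (hα : ∀ s, algebraMap R S (α s) = s) (n : ℕ) :
    Fintype.card ((tensor α G F hα).ι n) =
    ∑ pq ∈ Finset.HasAntidiagonal.antidiagonal n, Fintype.card (F.ι pq.1) * Fintype.card (G.ι pq.2) := by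
  rw [← Finset.Nat.sum_antidiagonal_swap]
  refine (Fintype.card_sigma (α := fun pq : Finset.HasAntidiagonal.antidiagonal n =>
    G.ι pq.1.1 × F.ι pq.1.2)).trans ?_
  simp only [Fintype.card_prod]
  rw [Finset.sum_coe_sort (Finset.HasAntidiagonal.antidiagonal n)
    fun pq => Fintype.card (G.ι pq.1) * Fintype.card (F.ι pq.2)]
  exact Finset.sum_congr rfl fun _ _ => mul_comm _ _

end MinimalFreeResolution

theorem proposition5p1 (R S : Type u) [CommRing R] [IsNoetherianRing R] [IsLocalRing R]
    [CommRing S] [IsNoetherianRing S] [IsLocalRing S]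
    (α : S →+* R) (β : R →+* S) (hβα : β.comp α = RingHom.id S)
    (N : Type u) [AddCommGroup N] [Module S N] [Module.Finite S N] :
    -- the vector spaces whose ranks enter the three series are finite-dimensional
    ((∀ i, Module.Finite (IsLocalRing.ResidueField R)
        (torResidue R i ((ModuleCat.restrictScalars β).obj (ModuleCat.of S N)))) ∧
      (∀ i, Module.Finite (IsLocalRing.ResidueField R)
        (torResidue R i ((ModuleCat.restrictScalars β).obj (ModuleCat.of S S)))) ∧
      (∀ i, Module.Finite (IsLocalRing.ResidueField S) (torResidue S i (ModuleCat.of S N)))) ∧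
    -- the equality of Poincaré series
    poincareSeries R ((ModuleCat.restrictScalars β).obj (ModuleCat.of S N)) =
      poincareSeries R ((ModuleCat.restrictScalars β).obj (ModuleCat.of S S)) *
        poincareSeries S (ModuleCat.of S N) := by
  let : Algebra R S := β.toAlgebra
  let : Module R N := Module.compHom N β
  have : IsScalarTower R S N := ⟨fun r s n => mul_smul (β r) s n⟩
  have hα (s : S) : algebraMap R S (α s) = s := RingHom.congr_fun hβα s
  -- The section `α` makes `β` surjective, so `S` is cyclic over `R` and `F` exists.
  have : Module.Finite R S := by
    refine Module.Finite.of_surjective (Algebra.linearMap R S) fun s => ⟨α s, hα s⟩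
  obtain ⟨G⟩ := MinimalFreeResolution.nonempty S N
  obtain ⟨F⟩ := MinimalFreeResolution.nonempty R S
  let G' : MinimalFreeResolution S (ModuleCat.of S N) := G
  let F' : MinimalFreeResolution R ((ModuleCat.restrictScalars β).obj (ModuleCat.of S S)) := F
  let T : MinimalFreeResolution R ((ModuleCat.restrictScalars β).obj (ModuleCat.of S N)) :=
    MinimalFreeResolution.tensor α G F hα
  refine ⟨⟨T.finite_torResidue, F'.finite_torResidue, G'.finite_torResidue⟩, ?_⟩
  ext n
  simp only [poincareSeries, PowerSeries.coeff_mul, PowerSeries.coeff_mk, T.finrank_torResidue,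
    F'.finrank_torResidue, G'.finrank_torResidue]
  exact_mod_cast MinimalFreeResolution.card_tensor α G F hα n
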